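/- Let $N\ge 1$, let $L\in\mathbb Z$ and let $l\in\mathbb Z\cup\{\infty\}$. For $U=(U_1,\dots,U_N)\in\mathbb Z^N$ and $c_1\in\mathbb Z$ put $$V_i=\min(c_i,L-U_i)+\max(0,U_i+c_i-l),\qquad c_{i+1}=U_i+c_i-V_i\qquad(1\le i\le N),$$ where the term $\max(0,\cdot)$ is $0$ if $l=\infty$, and $f(c_1)=c_{N+1}$. We say that $U$ *evolves as a periodic BBSC* (box–ball system with carrier, box capacity $L$, carrier capacity $l$) if some $c_1$ satisfies $f(c_1)=c_1$ and if $V=(V_1,\dots,V_N)$ is the same for all such $c_1$; then $V$ is the state at the next time. Let $U^0\in\mathbb Z^N$ be an initial state and let $m\ge 0$ be an integer such that the upward-shifted state $\tilde U^0=U^0+m$ and the box capacity $\tilde L=L+2m$ satisfy $0\le\tilde U^0_i\le\tilde L$ for all $i$. Let the carrier capacity $l$ satisfy $l+2m\ge 0$, and assume that $U^0$ evolves as a periodic BBSC for $(L,l)$ (for $l\ge L$ this follows from (a) below). Assume that, for box capacity $\tilde L$, both $\tilde U^0$ and the vacuum $(m,\dots,m)$ have the following two properties: (a) they evolve as a periodic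 BBSC for every carrier capacity in $[\tilde L,\infty]$; (b) for every integer carrier capacity $\geq 1$ there is $c_1\in\mathbb Z$ with $f(c_1)=c_1$. For an integer $k\ge 0$, the construction $(\mathrm{OP})_k$ for a state $W$ with $0\le W_i\le\tilde L$ is as follows. Choose an integer $0\le c_1\le k$ with $f(c_1)=c_1$ for box capacity $\tilde L$ and carrier capacity $k$. The carrier passes the boxes from left to right, periodically; when it holds $c$ balls it puts $\min(c,\tilde L-W_i)$ of them into box $i$ and takes the $\min(W_i,k-c)$ lowest balls out of box $i$, the lowest one first. The ball taken last is put back first. An arcline is drawn from each ball taken out of a box to the place where it is put into a box; arclines are counted once per period. Then: 1. The evolution $U^0,U^1,U^2,\dots$ of the periodic BBSC with parameters $L,l$ is defined uniquely for all times, each $U^t$ evolves as a periodic BBSC, and $0\le U^t_i+m\le\tilde L$ for all $t$ and $i$. 2. For every $k\ge 0$, the number of arclines drawn at $(\mathrm{OP})_k$ is well defined (some $c_1$ as above exists, and the number does not depend on its choice) for the vacuum $(m,\dots,m)$ and for $U^t+m$, $t\ge 0$. 3. For $k\ge 1$ let $\tilde C_k(t)$ be the number of arclines drawn at $(\mathrm{OP})_k$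 minus the number drawn at $(\mathrm{OP})_{k-1}$ for $U^t+m$, and let $C^0_k$ be the same difference for the vacuum $(m,\dots,m)$. Then $\tilde C_k(t)$ and $C_k(t)=\tilde C_k(t)-C_k^0$ do not depend on $t$. -/

import Mathlib

/-- The part `max (0, x - l)` of the update rule: what exceeds the carrier capacity `l`.
An unbounded carrier (`l = ⊤`) never overflows. -/
def bbscOverflow : WithTop ℤ → ℤ → ℤ
  | ⊤, _ => 0
  | (l : ℤ), x => max 0 (x - l)

/-- New content `min (c, L - u) + max (0, u + c - l)` of a box of capacity `L` holding `u` balls,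
after a carrier of capacity `l` holding `c` balls has passed. Negative values are allowed. -/
def bbscBox (L : ℤ) (l : WithTop ℤ) (u c : ℤ) : ℤ :=
  min c (L - u) + bbscOverflow l (u + c)

section Periodic

variable {N : ℕ} [NeZero N]

/-- Carrier content in front of the box number `n` (boxes `0, …, N - 1`, repeated periodically),
started with content `c₁` in front of box `0`. -/
def bbscCarrier (L : ℤ) (l : WithTop ℤ) (U : Fin N → ℤ) (c₁ : ℤ) : ℕ → ℤ
  | 0 => c₁
  | n + 1 =>
      U (Fin.ofNat N n) + bbscCarrier L l U c₁ n
        - bbscBox L l (U (Fin.ofNat N n)) (bbscCarrier L l U c₁ n)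

/-- The fixed point condition `f c₁ = c₁`: after one turn the carrier has its initial content. -/
def IsPeriodicCarrier (L : ℤ) (l : WithTop ℤ) (U : Fin N → ℤ) (c₁ : ℤ) : Prop :=
  bbscCarrier L l U c₁ N = c₁

/-- `V` arises from `U` by one periodic time step, for some admissible initial carrier content. -/
def IsPeriodicStep (L : ℤ) (l : WithTop ℤ) (U V : Fin N → ℤ) : Prop :=
  ∃ c₁ : ℤ, IsPeriodicCarrier L l U c₁ ∧
    ∀ i : Fin N, V i = bbscBox L l (U i) (bbscCarrier L l U c₁ i)

/-- `U` evolves as a periodic BBSC of size `N`: some `c₁` is a fixed point, and the next state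
does not depend on the choice of the fixed point. -/
def EvolvesPeriodically (L : ℤ) (l : WithTop ℤ) (U : Fin N → ℤ) : Prop :=
  ∃! V : Fin N → ℤ, IsPeriodicStep L l U V

/-- Periodic evolution is defined for all carrier capacities in `[L, ∞]`, and for every positive
capacity there is an integer fixed point `c₁`. -/
def HasPeriodicSystems (L : ℤ) (U : Fin N → ℤ) : Prop :=
  (∀ l : WithTop ℤ, (L : WithTop ℤ) ≤ l → EvolvesPeriodically L l U) ∧
    ∀ l : ℕ, 1 ≤ l → ∃ c₁ : ℤ, IsPeriodicCarrier L ((l : ℤ) : WithTop ℤ) U c₁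

/-- The upward shift by `m`. The capacities of boxes and carrier then increase by `2 m`. -/
def upShift (m : ℕ) (U : Fin N → ℤ) : Fin N → ℤ := fun i => U i + m

/-- The vacuum: every box holds exactly `m` balls. -/
def vacuum (N m : ℕ) : Fin N → ℤ := fun _ => m

/-! ### The arcline construction

The carrier is a stack of labelled balls, its head being the ball taken last. The ball `j` of
box `n` is labelled `some (n, j)`, where `j = 0` is the lowest ball and where boxes are counted
along the unrolled periodic system, so that `n` is a passage of the box `n mod N`. The label `none`
is for the balls which are on the carrier at the start.
-/

/-- The balls, in order, which a carrier with stack `S` puts into a box holding `u` balls: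
`min (c, L - u)` balls, last in, first out. -/
def putBalls (L u : ℤ) (S : List (Option (ℕ × ℕ))) : List (Option (ℕ × ℕ)) :=
  S.take (L - u).toNat

/-- The balls `min (u, l - c)` taken out of box `n`, which holds `u` balls, by a carrier with
stack `S`. The ball at the lowest position is taken first, hence is the last of this list. -/
def takenBalls (l : ℕ) (u : ℤ) (n : ℕ) (S : List (Option (ℕ × ℕ))) : List (Option (ℕ × ℕ)) :=
  ((List.range (min u.toNat (l - S.length))).map fun j => some (n, j)).reverse

/-- The stack of the carrier of capacity `l` in front of box `n`, starting with `c₁` balls. -/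
def carrierStack (L : ℤ) (l : ℕ) (U : Fin N → ℤ) (c₁ : ℕ) : ℕ → List (Option (ℕ × ℕ))
  | 0 => List.replicate c₁ none
  | n + 1 =>
      takenBalls l (U (Fin.ofNat N n)) n (carrierStack L l U c₁ n) ++
        (carrierStack L l U c₁ n).drop (L - U (Fin.ofNat N n)).toNat

/-- The arclines: pairs `((n, j), (k, s))` such that the ball `j` taken out of box `n` is the
ball number `s` put into box `k`. One representative for each arcline of the periodic
system is kept by letting the starting point `n` run through one period. -/
def arclines (L : ℤ) (l : ℕ) (U : Fin N → ℤ) (c₁ : ℕ) : Set ((ℕ × ℕ) × (ℕ × ℕ)) :=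
  {a | a.1.1 < N ∧
    (putBalls L (U (Fin.ofNat N a.2.1)) (carrierStack L l U c₁ a.2.1))[a.2.2]? = some (some a.1)}

/-- `k` is the number of arclines drawn by the construction with carrier capacity `l`, for some
periodic carrier which initially holds at most `l` balls. -/
def IsArclineNumber (L : ℤ) (l : ℕ) (U : Fin N → ℤ) (k : ℕ) : Prop :=
  ∃ c₁ : ℕ, c₁ ≤ l ∧ IsPeriodicCarrier L ((l : ℤ) : WithTop ℤ) U c₁ ∧
    (arclines L l U c₁).Finite ∧ (arclines L l U c₁).ncard = k

open Classical in
/-- The number of arclines (used only where `IsArclineNumber` has exactly one solution). -/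
noncomputable def arclineNumber (L : ℤ) (l : ℕ) (U : Fin N → ℤ) : ℕ :=
  if h : ∃ k, IsArclineNumber L l U k then h.choose else 0

/-- The number of arclines at capacity `l` minus the number at capacity `l - 1`, for `1 ≤ l`. -/
noncomputable def arclineDiff (L : ℤ) (l : ℕ) (U : Fin N → ℤ) : ℤ :=
  (arclineNumber L l U : ℤ) - arclineNumber L (l - 1) U

/-- The quantity `C_l` of a state `U` of the BBSC with box capacity `L`: the value for the
system shifted upward by `m`, minus the value for the vacuum. -/
noncomputable def conservedQuantity (L : ℤ) (m l : ℕ) (U : Fin N → ℤ) : ℤ :=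
  arclineDiff (L + 2 * m) l (upShift m U) - arclineDiff (L + 2 * m) l (vacuum N m)

end Periodic

/-! After the shift by `m` all contents lie between zero and the capacities. Every ball taken out of
a box is later put back, so the number of arclines is the number of balls put into boxes in one
period, the sum of `min c (L - u)` (`arclines_finite_ncard`). It is the same for all periodic
carriers (`sum_put_eq`): the distance of two carriers never grows, hence is constant over a period,
and then the difference of the counts telescopes to zero.

Conservation is an exchange relation of Yang–Baxter type (`bbscPass_exchange`). A counting carrier
of capacity `l` running over the next state can first pass the evolving carrier, regarded as a box
of capacity `k`, and then run over the old state. At each box the two counts differ by a term that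
telescopes over the period (`exists_carrier_of_step`).

The rest is existence and uniqueness. The hypotheses on a physical state imply `IsAdmissible`: at
most half filling and, for odd `N`, an empty or full box. This provides periodic carriers of every
nonnegative capacity and survives a time step. For carriers at least as large as the boxes the next
state is automatically unique. For smaller ones its uniqueness is that of the carrier, which is
inherited (`unique_carrier_of_step`). -/

/-- Content of the carrier after it has passed a box with content `u`. -/
def bbscPass (L : ℤ) (l : WithTop ℤ) (u c : ℤ) : ℤ := u + c - bbscBox L l u c

theorem bbscBox_coe (L l u c : ℤ) :
    bbscBox L (l : WithTop ℤ) u c = min c (L - u) + max 0 (u + c - l) := rfl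

theorem bbscBox_top (L u c : ℤ) : bbscBox L ⊤ u c = min c (L - u) + 0 := rfl

/-! ### Piecewise linear arithmetic of one carrier passing one box -/

section Local

variable {L l u c : ℤ}

theorem bbscBox_mem (hu : 0 ≤ u) (huL : u ≤ L) (hc : 0 ≤ c) (hcl : c ≤ l) :
    0 ≤ bbscBox L l u c ∧ bbscBox L l u c ≤ L := by
  rw [bbscBox_coe]; omega

theorem bbscPass_mem (hu : 0 ≤ u) (huL : u ≤ L) (hc : 0 ≤ c) (hcl : c ≤ l) :
    0 ≤ bbscPass L l u c ∧ bbscPass L l u c ≤ l := by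
  rw [bbscPass, bbscBox_coe]; omega

theorem bbscPass_mem_of_le (hu : 0 ≤ u) (huL : u ≤ L) (hl : L ≤ l) (c : ℤ) :
    0 ≤ bbscPass L l u c ∧ bbscPass L l u c ≤ l := by
  rw [bbscPass, bbscBox_coe]; omega

theorem bbscPass_top_nonneg (hu : 0 ≤ u) (c : ℤ) : 0 ≤ bbscPass L ⊤ u c := by
  rw [bbscPass, bbscBox_top]; omega

theorem bbscPass_mono_top (u : ℤ) {c d : ℤ} (h : c ≤ d) :
    bbscPass L ⊤ u c ≤ bbscPass L ⊤ u d ∧ bbscPass L ⊤ u d - bbscPass L ⊤ u c ≤ d - c := by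
  simp only [bbscPass, bbscBox_top]; omega

theorem bbscPass_mono (hl : L ≤ l) (u : ℤ) {c d : ℤ} (h : c ≤ d) :
    bbscPass L l u c ≤ bbscPass L l u d ∧ bbscPass L l u d - bbscPass L l u c ≤ d - c := by
  simp only [bbscPass, bbscBox_coe]; omega

/-- The middle branch of the pass now has slope -1. Only an even number of passes is monotone, which
is where the parity of `N` enters. -/
theorem bbscPass_anti (hl : l ≤ L) (u : ℤ) {c d : ℤ} (h : c ≤ d) :
    bbscPass L l u d ≤ bbscPass L l u c := by
  simp only [bbscPass, bbscBox_coe]; omega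

/-- Passing a box does not increase the distance of two carriers, and the numbers of balls put
into the box are determined up to a telescoping term when it is kept. -/
theorem abs_bbscPass_sub_le (L l u c d : ℤ) :
    |bbscPass L l u d - bbscPass L l u c| ≤ |d - c| ∧
      (|bbscPass L l u d - bbscPass L l u c| = |d - c| →
        2 * (min d (L - u) - min c (L - u)) =
          (d - c) - (bbscPass L l u d - bbscPass L l u c)) := by
  simp only [bbscPass, bbscBox_coe]
  rcases le_total l L with h | h <;> rcases le_total c d with h' | h' <;>
    simp only [abs_eq_max_neg] <;> constructor <;> intros <;> omega

/-- The overflow starts to grow at `c = l - u`, no later than the minimum saturates at `c = L - u`,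
so the new content increases strictly with `c`. -/
theorem bbscBox_injective (hl : l ≤ L) (u : ℤ) {c d : ℤ}
    (h : bbscBox L l u c = bbscBox L l u d) : c = d := by
  simp only [bbscBox_coe] at h; omega

/-- Eliminates `min` and `max`: for each order of the capacities there are three linear branches,
which carry the number of balls put as well. -/
theorem bbscPass_cases (L l u c : ℤ) :
    (L ≤ l →
      (u + c ≤ L ∧ bbscPass L l u c = u ∧ min c (L - u) = c) ∨
      (L ≤ u + c ∧ u + c ≤ l ∧ bbscPass L l u c = 2 * u + c - L ∧ min c (L - u) = L - u) ∨
      (l ≤ u + c ∧ bbscPass L l u c = u + l - L ∧ min c (L - u) = L - u)) ∧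
    (l ≤ L →
      (u + c ≤ l ∧ bbscPass L l u c = u ∧ min c (L - u) = c) ∨
      (l ≤ u + c ∧ u + c ≤ L ∧ bbscPass L l u c = l - c ∧ min c (L - u) = c) ∨
      (L ≤ u + c ∧ bbscPass L l u c = u + l - L ∧ min c (L - u) = L - u)) := by
  rw [bbscPass, bbscBox_coe]; omega

set_option maxHeartbeats 1000000 in
/-- Local exchange relation: a carrier of capacity `l` which passes a box behind a carrier of
capacity `k` may be exchanged with it. -/
theorem bbscPass_exchange {k l L u c d : ℤ} (hu : 0 ≤ u ∧ u ≤ L) (hc : 0 ≤ c ∧ c ≤ k)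
    (hd : 0 ≤ d ∧ d ≤ l) :
    bbscPass L l u (bbscPass k l c d) =
        bbscPass k l (bbscPass L k u c) (bbscPass L l (bbscBox L k u c) d) ∧
      min d (L - bbscBox L k u c) - min (bbscPass k l c d) (L - u) =
        min d (k - c) - min (bbscPass L l (bbscBox L k u c) d) (k - bbscPass L k u c) := by
  have hv : bbscBox L k u c = u + c - bbscPass L k u c := by rw [bbscPass]; ring
  generalize bbscBox L k u c = v at *
  have h₁ := bbscPass_cases L k u c
  generalize bbscPass L k u c = p₁ at *
  have h₂ := bbscPass_cases L l v d
  generalize bbscPass L l v d = p₂ at *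
  have h₃ := bbscPass_cases k l c d
  generalize bbscPass k l c d = p₃ at *
  have h₄ := bbscPass_cases L l u p₃
  generalize bbscPass L l u p₃ = p₄ at *
  have h₅ := bbscPass_cases k l p₁ p₂
  generalize bbscPass k l p₁ p₂ = p₅ at *
  generalize min d (L - v) = e₁ at *
  generalize min p₃ (L - u) = e₂ at *
  generalize min d (k - c) = e₃ at *
  generalize min p₂ (k - p₁) = e₄ at *
  -- The order of the three capacities selects the form of each pass. Three of the passes are split
  -- into branches; those of the other two are left to the arithmetic solver.
  rcases le_total k L with o₁ | o₁ <;> rcases le_total l L with o₂ | o₂ <;>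
    rcases le_total k l with o₃ | o₃ <;>
    (first | replace h₁ := h₁.1 o₁ | replace h₁ := h₁.2 o₁) <;>
    (first | replace h₂ := h₂.1 o₂ | replace h₂ := h₂.2 o₂) <;>
    (first | replace h₃ := h₃.1 o₃ | replace h₃ := h₃.2 o₃) <;>
    (first | replace h₄ := h₄.1 o₂ | replace h₄ := h₄.2 o₂) <;>
    (first | replace h₅ := h₅.1 o₃ | replace h₅ := h₅.2 o₃) <;>
    rcases h₁ with h₁ | h₁ | h₁ <;> rcases h₃ with h₃ | h₃ | h₃ <;>
    rcases h₂ with h₂ | h₂ | h₂ <;> lia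

end Local

/-! ### Periodic carriers: comparison of two carriers on one state -/

section Carrier

variable {N : ℕ} [NeZero N]

/-- The states for which all periodic evolutions are defined, for a box capacity `L`. -/
structure IsAdmissible (L : ℤ) (U : Fin N → ℤ) : Prop where
  mem : ∀ i, 0 ≤ U i ∧ U i ≤ L
  sum_le : 2 * ∑ i, U i ≤ N * L
  odd : Odd N → ∃ i, U i = 0 ∨ U i = L

theorem Fin.ofNat_add_period (n : ℕ) : Fin.ofNat N (n + N) = Fin.ofNat N n := by
  ext; simp [Fin.ofNat]

theorem Fin.ofNat_val_eq (i : Fin N) : Fin.ofNat N (i : ℕ) = i := by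
  ext; simp [Fin.ofNat, Nat.mod_eq_of_lt i.2]

theorem sum_eq_sum_range_ofNat (f : Fin N → ℤ) :
    ∑ i, f i = ∑ n ∈ Finset.range N, f (Fin.ofNat N n) := by
  rw [← Fin.sum_univ_eq_sum_range (fun n => f (Fin.ofNat N n))]
  simp only [Fin.ofNat_val_eq]

/-- The rigidity principle behind all comparisons of carriers: a distance that can only shrink but
returns after one period never changes. -/
theorem eq_of_antitone_of_eq {a : ℕ → ℤ} {N : ℕ} (h : ∀ n, a (n + 1) ≤ a n) (hN : a N = a 0)
    {n : ℕ} (hn : n ≤ N) : a n = a 0 := by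
  have ha : Antitone a := antitone_nat_of_succ_le h
  exact le_antisymm (ha (Nat.zero_le n)) (hN ▸ ha hn)

variable {L : ℤ} {l : WithTop ℤ} {U V : Fin N → ℤ} {c d : ℤ}

theorem bbscCarrier_zero : bbscCarrier L l U c 0 = c := rfl

theorem bbscCarrier_succ (n : ℕ) : bbscCarrier L l U c (n + 1) =
    bbscPass L l (U (Fin.ofNat N n)) (bbscCarrier L l U c n) := rfl

theorem exists_bbscCarrier_period_eq (L : ℤ) (l : WithTop ℤ) (U : Fin N → ℤ) (c : ℤ) :
    ∃ n, bbscCarrier L l U c N =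
      bbscPass L l (U (Fin.ofNat N n)) (bbscCarrier L l U c n) := by
  obtain ⟨n, hn⟩ := Nat.exists_eq_succ_of_ne_zero (NeZero.ne N)
  exact ⟨n, congrArg (bbscCarrier L l U c) hn⟩

theorem IsPeriodicCarrier.periodic (h : IsPeriodicCarrier L l U c) :
    Function.Periodic (bbscCarrier L l U c) N := by
  intro n
  induction n with
  | zero => rw [Nat.zero_add]; exact h
  | succ n ih =>
    rw [Nat.add_right_comm, bbscCarrier_succ, ih, Fin.ofNat_add_period,
      bbscCarrier_succ]

theorem isPeriodicStep_iff : IsPeriodicStep L l U V ↔ ∃ c, IsPeriodicCarrier L l U c ∧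
    ∀ n, V (Fin.ofNat N n) = bbscBox L l (U (Fin.ofNat N n)) (bbscCarrier L l U c n) := by
  constructor
  · rintro ⟨c, hc, hV⟩
    refine ⟨c, hc, fun n => ?_⟩
    rw [hV, ← hc.periodic.map_mod_nat n]
    rfl
  · rintro ⟨c, hc, hV⟩
    refine ⟨c, hc, fun i => ?_⟩
    have := hV i
    rwa [Fin.ofNat_val_eq] at this

theorem bbscCarrier_mem {l : ℤ} (hU : ∀ i, 0 ≤ U i ∧ U i ≤ L) (hc : 0 ≤ c ∧ c ≤ l) (n : ℕ) :
    0 ≤ bbscCarrier L l U c n ∧ bbscCarrier L l U c n ≤ l := by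
  induction n with
  | zero => exact hc
  | succ n ih =>
    rw [bbscCarrier_succ]
    exact bbscPass_mem (hU _).1 (hU _).2 ih.1 ih.2

theorem IsPeriodicCarrier.mem_of_le {l : ℤ} (h : IsPeriodicCarrier L l U c)
    (hU : ∀ i, 0 ≤ U i ∧ U i ≤ L) (hl : L ≤ l) : 0 ≤ c ∧ c ≤ l := by
  obtain ⟨n, hn⟩ := exists_bbscCarrier_period_eq L l U c
  rw [← show bbscCarrier L l U c N = c from h, hn]
  exact bbscPass_mem_of_le (hU _).1 (hU _).2 hl _

theorem IsPeriodicCarrier.top_nonneg (h : IsPeriodicCarrier L ⊤ U c)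
    (hU : ∀ i, 0 ≤ U i ∧ U i ≤ L) : 0 ≤ c := by
  obtain ⟨n, hn⟩ := exists_bbscCarrier_period_eq L ⊤ U c
  rw [← show bbscCarrier L ⊤ U c N = c from h, hn]
  exact bbscPass_top_nonneg (hU _).1 _

/-- The number of balls put into boxes does not depend on the periodic carrier. -/
theorem sum_put_eq {l : ℤ} (hc : IsPeriodicCarrier L l U c) (hd : IsPeriodicCarrier L l U d) :
    ∑ n ∈ Finset.range N, min (bbscCarrier L l U d n) (L - U (Fin.ofNat N n)) =
      ∑ n ∈ Finset.range N, min (bbscCarrier L l U c n) (L - U (Fin.ofNat N n)) := by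
  set C := bbscCarrier L l U c with hC
  set D := bbscCarrier L l U d with hD
  have hN : D N = D 0 ∧ C N = C 0 := ⟨hd, hc⟩
  have key : ∀ n, n ≤ N → |D n - C n| = |D 0 - C 0| := fun n hn =>
    eq_of_antitone_of_eq (a := fun n => |D n - C n|)
      (fun n => (abs_bbscPass_sub_le L l (U (Fin.ofNat N n)) (C n) (D n)).1)
      (by simp only [hN.1, hN.2]) hn
  have h : 2 * ∑ n ∈ Finset.range N, (min (D n) (L - U (Fin.ofNat N n)) -
      min (C n) (L - U (Fin.ofNat N n))) = 0 := by
    rw [Finset.mul_sum]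
    calc _ = ∑ n ∈ Finset.range N, ((D n - C n) - (D (n + 1) - C (n + 1))) := by
          refine Finset.sum_congr rfl fun n hn => ?_
          have hn := Finset.mem_range.1 hn
          exact (abs_bbscPass_sub_le L l (U (Fin.ofNat N n)) (C n) (D n)).2
            ((key (n + 1) hn).trans (key n hn.le).symm)
      _ = 0 := by
          rw [Finset.sum_range_sub' (fun n => D n - C n), hN.1, hN.2, sub_self]
  rw [Finset.sum_sub_distrib] at h
  omega

/-- Passes that preserve order and do not expand keep the difference of two periodic carriers
constant, and ball balance then forces equal boxes. Stated through `hpass` to cover finite and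
unbounded carriers together. -/
theorem box_eq_of_pass (hpass : ∀ u c d, c ≤ d →
      bbscPass L l u c ≤ bbscPass L l u d ∧ bbscPass L l u d - bbscPass L l u c ≤ d - c)
    (hc : IsPeriodicCarrier L l U c) (hd : IsPeriodicCarrier L l U d) (hcd : c ≤ d) {n : ℕ}
    (hn : n < N) :
    bbscBox L l (U (Fin.ofNat N n)) (bbscCarrier L l U c n) =
      bbscBox L l (U (Fin.ofNat N n)) (bbscCarrier L l U d n) := by
  set C := bbscCarrier L l U c with hC
  set D := bbscCarrier L l U d with hD
  have hN : D N = D 0 ∧ C N = C 0 := ⟨hd, hc⟩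
  have hle : ∀ n, C n ≤ D n := by
    intro n
    induction n with
    | zero => exact hcd
    | succ n ih => exact (hpass _ _ _ ih).1
  have key : ∀ n, n ≤ N → D n - C n = D 0 - C 0 := fun n hn =>
    eq_of_antitone_of_eq (a := fun n => D n - C n) (fun n => (hpass _ _ _ (hle n)).2)
      (by simp only [hN.1, hN.2]) hn
  have h := (key (n + 1) hn).trans (key n hn.le).symm
  have h₁ : C (n + 1) = U (Fin.ofNat N n) + C n - bbscBox L l (U (Fin.ofNat N n)) (C n) := rfl
  have h₂ : D (n + 1) = U (Fin.ofNat N n) + D n - bbscBox L l (U (Fin.ofNat N n)) (D n) := rfl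
  omega

/-- For a carrier which is at least as large as the boxes the next state is unique. -/
theorem IsPeriodicStep.unique {V' : Fin N → ℤ} (hl : (L : WithTop ℤ) ≤ l)
    (hV : IsPeriodicStep L l U V) (hV' : IsPeriodicStep L l U V') : V = V' := by
  have hpass : ∀ u c d, c ≤ d →
      bbscPass L l u c ≤ bbscPass L l u d ∧ bbscPass L l u d - bbscPass L l u c ≤ d - c := by
    intro u c d h
    cases l with
    | top => exact bbscPass_mono_top u h
    | coe l => exact bbscPass_mono (WithTop.coe_le_coe.1 hl) u h
  obtain ⟨c, hc, hV⟩ := hV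
  obtain ⟨d, hd, hV'⟩ := hV'
  ext i
  rw [hV, hV']
  rcases le_total c d with h | h
  · have := box_eq_of_pass hpass hc hd h i.2
    rwa [Fin.ofNat_val_eq] at this
  · have := box_eq_of_pass hpass hd hc h i.2
    rw [Fin.ofNat_val_eq] at this
    exact this.symm

/-- For a carrier which is at most as large as the boxes the next state determines the carrier. -/
theorem EvolvesPeriodically.unique_carrier {l : ℤ} (h : EvolvesPeriodically L l U) (hl : l ≤ L)
    (hc : IsPeriodicCarrier L l U c) (hd : IsPeriodicCarrier L l U d) : c = d := by
  have := h.unique ⟨c, hc, fun _ => rfl⟩ ⟨d, hd, fun _ => rfl⟩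
  exact bbscBox_injective hl _ (congrFun this (Fin.ofNat N 0))

/-! ### Existence of periodic carriers and admissible states -/

theorem exists_fixedPoint_of_monotone {f : ℤ → ℤ} (hf : Monotone f) {l : ℤ} (hl : 0 ≤ l)
    (h₀ : 0 ≤ f 0) (h₁ : f l ≤ l) : ∃ c, 0 ≤ c ∧ c ≤ l ∧ f c = c := by
  obtain ⟨n, rfl⟩ := Int.eq_ofNat_of_zero_le hl
  classical
  -- The least such `k` is a fixed point: by monotonicity `f k` has the same property, so it cannot
  -- be smaller.
  have hex : ∃ k : ℕ, f k ≤ k := ⟨n, h₁⟩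
  have hk := Nat.find_spec hex
  refine ⟨Nat.find hex, by omega, ?_, le_antisymm hk ?_⟩
  · exact_mod_cast Nat.find_le h₁
  · have hnn : 0 ≤ f (Nat.find hex) := h₀.trans (hf (by omega))
    obtain ⟨k, hfk⟩ := Int.eq_ofNat_of_zero_le hnn
    rw [hfk]
    have : f k ≤ k := by
      rw [← Int.ofNat_eq_natCast, Int.ofNat_eq_natCast, ← hfk]; exact hf hk
    exact_mod_cast Nat.find_le this

theorem bbscCarrier_mono (hl : (L : WithTop ℤ) ≤ l) (n : ℕ) :
    Monotone fun c => bbscCarrier L l U c n := by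
  induction n with
  | zero => exact monotone_id
  | succ n ih =>
    intro c d h
    simp only [bbscCarrier_succ]
    cases l with
    | top => exact (bbscPass_mono_top _ (ih h)).1
    | coe l => exact (bbscPass_mono (WithTop.coe_le_coe.1 hl) _ (ih h)).1

theorem bbscCarrier_mono_of_even {l : ℤ} (hl : l ≤ L) (k : ℕ) :
    Monotone fun c => bbscCarrier L l U c (k + k) := by
  induction k with
  | zero => exact monotone_id
  | succ k ih =>
    intro c d h
    rw [show k + 1 + (k + 1) = k + k + 1 + 1 by ring]
    simp only [bbscCarrier_succ]
    exact bbscPass_anti hl _ (bbscPass_anti hl _ (ih h))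

theorem bbscCarrier_eq_of_le {c d : ℤ} {k n : ℕ} (hkn : k ≤ n)
    (h : bbscCarrier L l U c k = bbscCarrier L l U d k) :
    bbscCarrier L l U c n = bbscCarrier L l U d n := by
  induction n, hkn using Nat.le_induction with
  | base => exact h
  | succ n _ ih => rw [bbscCarrier_succ, bbscCarrier_succ, ih]

theorem bbscPass_of_extreme {L l u c : ℤ} (hl : l ≤ L) (hc : 0 ≤ c ∧ c ≤ l) :
    (u = 0 → bbscPass L l u c = 0) ∧ (u = L → bbscPass L l u c = l) := by
  rw [bbscPass, bbscBox_coe]; omega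

/-- There is a periodic carrier for every capacity. -/
theorem IsAdmissible.exists_carrier (hU : IsAdmissible L U) {l : ℤ} (hl : 0 ≤ l) :
    ∃ c, 0 ≤ c ∧ c ≤ l ∧ IsPeriodicCarrier L l U c := by
  have h₀ := (bbscCarrier_mem hU.mem ⟨le_rfl, hl⟩ N).1
  have h₁ := (bbscCarrier_mem hU.mem ⟨hl, le_rfl⟩ N).2
  rcases le_total L l with h | h
  · exact exists_fixedPoint_of_monotone (bbscCarrier_mono (WithTop.coe_le_coe.2 h) N) hl h₀ h₁
  rcases Nat.even_or_odd N with hN | hN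
  · obtain ⟨k, hk⟩ := hN
    refine exists_fixedPoint_of_monotone (f := fun c => bbscCarrier L l U c N) ?_ hl h₀ h₁
    have := bbscCarrier_mono_of_even (U := U) h k
    rwa [← hk] at this
  -- An empty box leaves the carrier empty and a full one leaves it full. The content after one turn
  -- is thus independent of the start in `[0, l]`, and the value reached from `0` is a fixed point.
  · obtain ⟨i, hi⟩ := hU.odd hN
    have hmem := bbscCarrier_mem hU.mem ⟨le_rfl, hl⟩ N
    refine ⟨bbscCarrier L l U 0 N, hmem.1, hmem.2, bbscCarrier_eq_of_le i.2 ?_⟩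
    rw [bbscCarrier_succ, bbscCarrier_succ, Fin.ofNat_val_eq]
    have e₁ := bbscPass_of_extreme (u := U i) h (bbscCarrier_mem hU.mem hmem i)
    have e₂ := bbscPass_of_extreme (u := U i) h (bbscCarrier_mem hU.mem ⟨le_rfl, hl⟩ i)
    rcases hi with hi | hi
    · rw [e₁.1 hi, e₂.1 hi]
    · rw [e₁.2 hi, e₂.2 hi]

/-- At most `L - u` balls are put and, without overflow, all `u` are taken, so a pass gains at least
`2 * u - L`. The total gain over a period is zero. -/
theorem IsPeriodicCarrier.sum_le (hc : IsPeriodicCarrier L ⊤ U c) : 2 * ∑ i, U i ≤ N * L := by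
  have h : ∑ n ∈ Finset.range N, (2 * U (Fin.ofNat N n) - L) ≤
      ∑ n ∈ Finset.range N, (bbscCarrier L ⊤ U c (n + 1) - bbscCarrier L ⊤ U c n) := by
    refine Finset.sum_le_sum fun n _ => ?_
    rw [bbscCarrier_succ, bbscPass, bbscBox_top]
    omega
  rw [Finset.sum_range_sub, show bbscCarrier L ⊤ U c N = c from hc, bbscCarrier_zero, sub_self,
    Finset.sum_sub_distrib, ← Finset.mul_sum, ← sum_eq_sum_range_ofNat U, Finset.sum_const,
    Finset.card_range, nsmul_eq_mul] at h
  linarith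

theorem IsAdmissible.exists_carrier_top (hU : IsAdmissible L U) :
    ∃ c, IsPeriodicCarrier L ⊤ U c := by
  have hL : 0 ≤ L := (hU.mem 0).1.trans (hU.mem 0).2
  -- Started with `N * L` balls, the carrier holds at least `L` in front of every box of the period
  -- and gains exactly `2 * u - L` there. Half filling then gives `f (N * L) ≤ N * L`.
  have key : ∀ n ≤ N, bbscCarrier L ⊤ U (N * L) n =
      N * L + ∑ k ∈ Finset.range n, (2 * U (Fin.ofNat N k) - L) ∧
      (N - n : ℤ) * L ≤ bbscCarrier L ⊤ U (N * L) n := by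
    intro n
    induction n with
    | zero => intro _; simp [bbscCarrier_zero]
    | succ n ih =>
      intro hn
      obtain ⟨ih₁, ih₂⟩ := ih (by omega)
      have h₁ : (1 : ℤ) ≤ N - n := by omega
      have h₂ : L ≤ (N - n : ℤ) * L := by nlinarith
      have hu := hU.mem (Fin.ofNat N n)
      have h₃ : bbscCarrier L ⊤ U (N * L) (n + 1) =
          bbscCarrier L ⊤ U (N * L) n + (2 * U (Fin.ofNat N n) - L) := by
        rw [bbscCarrier_succ, bbscPass, bbscBox_top]
        omega
      constructor
      · rw [h₃, ih₁, Finset.sum_range_succ, add_assoc]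
      · have h₄ : ((N : ℤ) - (n + 1 : ℕ)) * L = (N - n) * L - L := by push_cast; ring
        omega
  have h₁ : bbscCarrier L ⊤ U (N * L) N ≤ N * L := by
    have h := hU.sum_le
    rw [(key N le_rfl).1, Finset.sum_sub_distrib, ← Finset.mul_sum, ← sum_eq_sum_range_ofNat U,
      Finset.sum_const, Finset.card_range, nsmul_eq_mul]
    linarith
  have h₀ : 0 ≤ bbscCarrier L ⊤ U 0 N := by
    obtain ⟨n, hn⟩ := exists_bbscCarrier_period_eq L ⊤ U 0
    rw [hn]
    exact bbscPass_top_nonneg (hU.mem _).1 _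
  obtain ⟨c, -, -, hc⟩ := exists_fixedPoint_of_monotone (bbscCarrier_mono (U := U) le_top N)
    (by positivity : (0 : ℤ) ≤ N * L) h₀ h₁
  exact ⟨c, hc⟩

theorem IsAdmissible.evolves_of_le (hU : IsAdmissible L U) (hl : (L : WithTop ℤ) ≤ l) :
    EvolvesPeriodically L l U := by
  have hL : 0 ≤ L := (hU.mem 0).1.trans (hU.mem 0).2
  have hex : ∃ c, IsPeriodicCarrier L l U c := by
    cases l with
    | top => exact hU.exists_carrier_top
    | coe l =>
      obtain ⟨c, -, -, hc⟩ := hU.exists_carrier (hL.trans (WithTop.coe_le_coe.1 hl))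
      exact ⟨c, hc⟩
  obtain ⟨c, hc⟩ := hex
  exact ⟨_, ⟨c, hc, fun _ => rfl⟩, fun V hV => hV.unique hl ⟨c, hc, fun _ => rfl⟩⟩

theorem HasPeriodicSystems.isAdmissible (hU : ∀ i, 0 ≤ U i ∧ U i ≤ L)
    (h : HasPeriodicSystems L U) : IsAdmissible L U := by
  refine ⟨hU, ?_, fun hN => ?_⟩
  · obtain ⟨V, ⟨c, hc, -⟩, -⟩ := h.1 ⊤ le_top
    exact hc.sum_le
  · by_contra hcon
    push Not at hcon
    obtain ⟨c, hc⟩ := h.2 1 le_rfl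
    -- If no box is empty or full, a carrier of capacity one toggles between `c ≤ 0` and `c ≥ 1`,
    -- which an odd period forbids. Inequalities are used since `c` need not lie in `[0, 1]`.
    have step : ∀ n, (bbscCarrier L ((1 : ℕ) : ℤ) U c n ≤ 0 ↔
        ¬ bbscCarrier L ((1 : ℕ) : ℤ) U c (n + 1) ≤ 0) := by
      intro n
      have h₁ := hcon (Fin.ofNat N n)
      have h₂ := hU (Fin.ofNat N n)
      rw [bbscCarrier_succ, bbscPass, bbscBox_coe]
      omega
    have step₂ : ∀ k, (bbscCarrier L ((1 : ℕ) : ℤ) U c (2 * k) ≤ 0 ↔ c ≤ 0) := by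
      intro k
      induction k with
      | zero => exact Iff.rfl
      | succ k ih =>
        rw [← ih, show 2 * (k + 1) = 2 * k + 1 + 1 by ring, step (2 * k), step (2 * k + 1), not_not]
    obtain ⟨k, hk⟩ := hN
    have h₁ := step (2 * k)
    rw [← hk, show bbscCarrier L ((1 : ℕ) : ℤ) U c N = c from hc, step₂] at h₁
    tauto

end Carrier

/-! ### One time step: finite carriers, admissibility and exchange -/

section Step

variable {N : ℕ} [NeZero N] {L k l : ℤ} {U V : Fin N → ℤ} {c d : ℤ}

theorem bbscCarrier_eq_of_top {K : ℤ}
    (h : ∀ n, U (Fin.ofNat N n) + bbscCarrier L ⊤ U c n ≤ K) (n : ℕ) :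
    bbscCarrier L K U c n = bbscCarrier L ⊤ U c n := by
  induction n with
  | zero => rfl
  | succ n ih =>
    have := h n
    rw [bbscCarrier_succ, bbscCarrier_succ, ih, bbscPass, bbscPass, bbscBox_coe, bbscBox_top]
    omega

/-- Every periodic step is a step of a carrier of finite capacity which initially holds a number of
balls between zero and the capacity. -/
theorem IsPeriodicStep.exists_finite {κ : WithTop ℤ} (hκ : 0 ≤ κ) (hU : IsAdmissible L U)
    (hE : EvolvesPeriodically L κ U) (hV : IsPeriodicStep L κ U V) :
    ∃ k c : ℤ, (0 ≤ c ∧ c ≤ k) ∧ IsPeriodicCarrier L k U c ∧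
      (∀ n, V (Fin.ofNat N n) = bbscBox L k (U (Fin.ofNat N n)) (bbscCarrier L k U c n)) ∧
      ((L : WithTop ℤ) ≤ κ ∨ κ = k) := by
  cases κ with
  | top =>
    obtain ⟨c, hc, hV⟩ := isPeriodicStep_iff.1 hV
    -- By periodicity the contents `u + c` are bounded; a capacity `K` above them never overflows
    -- and acts as an unbounded one.
    obtain ⟨K, hK⟩ := Finset.exists_le
      ((Finset.range N).image fun n => U (Fin.ofNat N n) + bbscCarrier L ⊤ U c n)
    have hbd : ∀ n, U (Fin.ofNat N n) + bbscCarrier L ⊤ U c n ≤ K := by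
      intro n
      have := hK _ (Finset.mem_image_of_mem _
        (Finset.mem_range.2 (Nat.mod_lt n (NeZero.pos N))))
      rwa [hc.periodic.map_mod_nat, show Fin.ofNat N (n % N) = Fin.ofNat N n by
        ext; simp [Fin.ofNat]] at this
    have hcar := bbscCarrier_eq_of_top hbd
    refine ⟨K, c, ⟨hc.top_nonneg hU.mem, ?_⟩, (hcar N).trans hc, fun n => ?_, Or.inl le_top⟩
    · exact (le_add_of_nonneg_left (hU.mem _).1).trans (hbd 0)
    · have := hbd n
      rw [hV, hcar, bbscBox_coe, bbscBox_top]
      omega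
  | coe k =>
    -- The carrier that realises the step may lie outside `[0, k]`. Uniqueness of the next state
    -- permits replacing it by one inside.
    obtain ⟨c, h₀, h₁, hc⟩ := hU.exists_carrier (WithTop.coe_le_coe.1 hκ)
    have := hE.unique hV ⟨c, hc, fun _ => rfl⟩
    obtain rfl := this
    obtain ⟨W, hW⟩ := hE
    refine ⟨k, c, ⟨h₀, h₁⟩, hc, fun n => ?_, Or.inr rfl⟩
    change bbscBox L k (U (Fin.ofNat N n)) (bbscCarrier L k U c (n % N)) = _
    rw [hc.periodic.map_mod_nat]

/-- If box `i` does not stay extreme, the carrier leaves it empty (for `U i = 0`) or full (for `U i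
= L`), and this makes the following box empty or full. -/
theorem exists_extreme_of_le (hU : ∀ i, 0 ≤ U i ∧ U i ≤ L) (hk : L ≤ k) (hc : 0 ≤ c ∧ c ≤ k)
    (hV : ∀ n, V (Fin.ofNat N n) = bbscBox L k (U (Fin.ofNat N n)) (bbscCarrier L k U c n))
    {i : Fin N} (hi : U i = 0 ∨ U i = L) : ∃ j, V j = 0 ∨ V j = L := by
  have h₁ := hV i
  have h₂ := hV (i + 1)
  have h₃ := hU (Fin.ofNat N (i + 1))
  have h₄ := bbscCarrier_mem hU hc i
  rw [bbscCarrier_succ, Fin.ofNat_val_eq, bbscPass] at h₂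
  rw [Fin.ofNat_val_eq] at h₁
  rw [bbscBox_coe] at h₁ h₂
  rw [bbscBox_coe] at h₂
  by_contra! hcon
  have h₅ := hcon i
  have h₆ := hcon (Fin.ofNat N (i + 1))
  omega

theorem exists_extreme_of_ge (hN : Odd N) (hU : ∀ i, 0 ≤ U i ∧ U i ≤ L) (hk : k ≤ L)
    (hc : 0 ≤ c ∧ c ≤ k)
    (hV : ∀ n, V (Fin.ofNat N n) = bbscBox L k (U (Fin.ofNat N n)) (bbscCarrier L k U c n))
    {i : Fin N} (hi : U i = 0 ∨ U i = L) : ∃ j, V j = 0 ∨ V j = L := by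
  by_contra! hcon
  -- Without an extreme box in the next state, an empty carrier must fill up at each box and a full
  -- one must empty. Box `i` leaves it at `0` or `k`; after `N - 1`, an even number, of further
  -- boxes it meets box `i` with that content and leaves it extreme.
  have hstep : ∀ n, (bbscCarrier L k U c n = 0 → bbscCarrier L k U c (n + 1) = k) ∧
      (bbscCarrier L k U c n = k → bbscCarrier L k U c (n + 1) = 0) := by
    intro n
    have h₁ := hV n
    have h₂ := hcon (Fin.ofNat N n)
    have h₃ := hU (Fin.ofNat N n)
    have h₄ := bbscCarrier_mem hU hc n
    rw [bbscCarrier_succ, bbscPass]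
    rw [bbscBox_coe] at h₁ ⊢
    omega
  have h₁ := bbscPass_of_extreme (u := U i) hk (bbscCarrier_mem hU hc i)
  have hs : bbscCarrier L k U c (i + 1) = bbscPass L k (U i) (bbscCarrier L k U c i) := by
    rw [bbscCarrier_succ, Fin.ofNat_val_eq]
  have heven : ∀ q, (bbscCarrier L k U c (i + 1) = 0 → bbscCarrier L k U c (i + 1 + 2 * q) = 0) ∧
      (bbscCarrier L k U c (i + 1) = k → bbscCarrier L k U c (i + 1 + 2 * q) = k) := by
    intro q
    induction q with
    | zero => exact ⟨id, id⟩
    | succ q ih =>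
      have e : (i : ℕ) + 1 + 2 * (q + 1) = i + 1 + 2 * q + 1 + 1 := by ring
      rw [e]
      exact ⟨fun h => (hstep _).2 ((hstep _).1 (ih.1 h)), fun h => (hstep _).1 ((hstep _).2 (ih.2 h))⟩
  obtain ⟨q, hq⟩ := hN
  have h₂ := heven q
  have h₃ := hV (i + N)
  rw [show (i : ℕ) + 1 + 2 * q = i + N by omega] at h₂
  rw [Fin.ofNat_add_period, Fin.ofNat_val_eq, bbscBox_coe] at h₃
  have h₄ := hcon i
  have h₅ := hU i
  rcases hi with hi | hi
  · have := h₂.1 (hs.trans (h₁.1 hi)); omega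
  · have := h₂.2 (hs.trans (h₁.2 hi)); omega

theorem IsAdmissible.step (hU : IsAdmissible L U) (hc : 0 ≤ c ∧ c ≤ k)
    (hp : IsPeriodicCarrier L k U c)
    (hV : ∀ n, V (Fin.ofNat N n) = bbscBox L k (U (Fin.ofNat N n)) (bbscCarrier L k U c n)) :
    IsAdmissible L V := by
  refine ⟨fun i => ?_, ?_, fun hN => ?_⟩
  · have h₁ := bbscCarrier_mem hU.mem hc i
    have h₂ := hV i
    rw [Fin.ofNat_val_eq] at h₂
    rw [h₂]
    exact bbscBox_mem (hU.mem i).1 (hU.mem i).2 h₁.1 h₁.2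
  · have : ∑ i, V i = ∑ i, U i := by
      rw [sum_eq_sum_range_ofNat, sum_eq_sum_range_ofNat U, ← sub_eq_zero,
        ← Finset.sum_sub_distrib]
      calc _ = ∑ n ∈ Finset.range N, (bbscCarrier L k U c n - bbscCarrier L k U c (n + 1)) := by
            refine Finset.sum_congr rfl fun n _ => ?_
            rw [hV, bbscCarrier_succ, bbscPass]
            ring
        _ = 0 := by
          rw [Finset.sum_range_sub', show bbscCarrier L k U c N = c from hp, bbscCarrier_zero,
            sub_self]
    rw [this]
    exact hU.sum_le
  · obtain ⟨i, hi⟩ := hU.odd hN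
    rcases le_total L k with h | h
    · exact exists_extreme_of_le hU.mem h hc hV hi
    · exact exists_extreme_of_ge hN hU.mem h hc hV hi

/-- The carrier of capacity `l` on the next state is exchanged with a carrier of capacity `l` on
the given state, which puts the same number of balls into boxes. -/
theorem exists_carrier_of_step (hU : ∀ i, 0 ≤ U i ∧ U i ≤ L) (hc : 0 ≤ c ∧ c ≤ k)
    (hp : IsPeriodicCarrier L k U c)
    (hV : ∀ n, V (Fin.ofNat N n) = bbscBox L k (U (Fin.ofNat N n)) (bbscCarrier L k U c n))
    (hVm : ∀ i, 0 ≤ V i ∧ V i ≤ L)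
    (hd : 0 ≤ d ∧ d ≤ l) (hq : IsPeriodicCarrier L l V d) :
    ∃ e, (0 ≤ e ∧ e ≤ l) ∧ IsPeriodicCarrier L l U e ∧
      ∑ n ∈ Finset.range N, min (bbscCarrier L l V d n) (L - V (Fin.ofNat N n)) =
        ∑ n ∈ Finset.range N, min (bbscCarrier L l U e n) (L - U (Fin.ofNat N n)) := by
  set C := bbscCarrier L k U c with hC
  set D := bbscCarrier L l V d with hD
  have hCm : ∀ n, 0 ≤ C n ∧ C n ≤ k := bbscCarrier_mem hU hc
  have hDm : ∀ n, 0 ≤ D n ∧ D n ≤ l := bbscCarrier_mem hVm hd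
  have hex := fun n => bbscPass_exchange (hU (Fin.ofNat N n)) (hCm n) (hDm n)
  have hCs : ∀ n, bbscPass L k (U (Fin.ofNat N n)) (C n) = C (n + 1) := fun n => rfl
  have hDs : ∀ n, bbscPass L l (V (Fin.ofNat N n)) (D n) = D (n + 1) := fun n => rfl
  simp only [hCs, ← hV, hDs] at hex
  have hN : C N = C 0 ∧ D N = D 0 := ⟨hp, hq⟩
  -- The evolving carrier `C n` plays the part of a box of capacity `k` holding `C n` balls, passed
  -- by `D n`.
  have hcar : ∀ n, bbscCarrier L l U (bbscPass k l (C 0) (D 0)) n = bbscPass k l (C n) (D n) := by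
    intro n
    induction n with
    | zero => rfl
    | succ n ih => rw [bbscCarrier_succ, ih, (hex n).1]
  refine ⟨bbscPass k l (C 0) (D 0), bbscPass_mem (hCm 0).1 (hCm 0).2 (hDm 0).1 (hDm 0).2, ?_, ?_⟩
  · rw [IsPeriodicCarrier, hcar, hN.1, hN.2]
  · rw [← sub_eq_zero, ← Finset.sum_sub_distrib]
    simp only [hcar, (hex _).2]
    rw [Finset.sum_range_sub' (fun n => min (D n) (k - C n)), hN.1, hN.2, sub_self]

/-! ### Inheritance of uniqueness for carriers smaller than the boxes -/

theorem eq_of_antitone_of_periodic {a : ℕ → ℤ} (h : ∀ n, a (n + 1) ≤ a n)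
    (hN : Function.Periodic a N) (n : ℕ) : a n = a 0 := by
  rw [← hN.map_mod_nat n]
  exact eq_of_antitone_of_eq h hN.eq (Nat.mod_lt n (NeZero.pos N)).le

/-- The outer branches of the pass are constant and the middle one has slope -1, so two distinct
carriers keep their distance only inside the middle branch. -/
theorem middle_of_abs_eq {L k u c d : ℤ} (hk : k < L)
    (h : |bbscPass L k u d - bbscPass L k u c| = |d - c|) (hne : c ≠ d) :
    k ≤ u + c ∧ u + c ≤ L := by
  have h₁ := (bbscPass_cases L k u c).2 hk.le
  have h₂ := (bbscPass_cases L k u d).2 hk.le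
  rw [abs_eq_abs] at h
  omega

theorem bbscPass_of_middle {L k u c : ℤ} (h : k ≤ u + c ∧ u + c ≤ L) :
    bbscPass L k u c = k - c := by
  rw [bbscPass, bbscBox_coe]; omega

theorem bbscBox_of_middle {L k u c : ℤ} (h : k ≤ u + c ∧ u + c ≤ L) :
    bbscBox L k u c = u + 2 * c - k := by
  rw [bbscBox_coe]; omega

/-- In the middle regime a pass is the reflection `d ↦ k - d`. The right-hand distance is therefore
that of the carrier on the old state to the reflected carrier on the new one, one box later; it
cannot decrease. -/
theorem abs_sub_le_of_middle {L k u c d : ℤ} (hk : k < L)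
    (h : k ≤ bbscBox L k u c + d ∧ bbscBox L k u c + d ≤ L) :
    |c - (k - d)| ≤ |bbscPass L k u c - d| ∧
      (|bbscPass L k u c - d| = |c - (k - d)| → c ≠ k - d → k ≤ u + c ∧ u + c ≤ L) := by
  have hv : bbscBox L k u c = u + c - bbscPass L k u c := by rw [bbscPass]; ring
  have h₁ := (bbscPass_cases L k u c).2 hk.le
  refine ⟨?_, fun h₂ h₃ => ?_⟩
  · rcases abs_cases (c - (k - d)) with h₂ | h₂ <;>
      rcases abs_cases (bbscPass L k u c - d) with h₃ | h₃ <;> omega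
  · rw [abs_eq_abs] at h₂
    omega

theorem carrier_middle_of_ne {e : ℤ} (hk : k < L) (hd : IsPeriodicCarrier L k V d)
    (he : IsPeriodicCarrier L k V e) (hne : d ≠ e) (n : ℕ) :
    k ≤ V (Fin.ofNat N n) + bbscCarrier L k V d n ∧
      V (Fin.ofNat N n) + bbscCarrier L k V d n ≤ L := by
  have key := eq_of_antitone_of_periodic (N := N)
    (a := fun n => |bbscCarrier L k V e n - bbscCarrier L k V d n|)
    (fun n => (abs_bbscPass_sub_le L k (V (Fin.ofNat N n)) _ _).1)
    (fun n => by simp only [hd.periodic n, he.periodic n])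
  refine middle_of_abs_eq hk ((key (n + 1)).trans (key n).symm) fun h => hne ?_
  have := key n
  simp only [h, sub_self, abs_zero, bbscCarrier_zero] at this
  exact (sub_eq_zero.1 (abs_eq_zero.1 this.symm)).symm

theorem prev_carrier_middle (hk : k < L) (hp : IsPeriodicCarrier L k U c)
    (hV : ∀ n, V (Fin.ofNat N n) = bbscBox L k (U (Fin.ofNat N n)) (bbscCarrier L k U c n))
    (hd : IsPeriodicCarrier L k V d)
    (hm : ∀ n, k ≤ V (Fin.ofNat N n) + bbscCarrier L k V d n ∧
      V (Fin.ofNat N n) + bbscCarrier L k V d n ≤ L) (hne : c ≠ k - d) (n : ℕ) :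
    k ≤ U (Fin.ofNat N n) + bbscCarrier L k U c n ∧
      U (Fin.ofNat N n) + bbscCarrier L k U c n ≤ L := by
  have hD : ∀ n, bbscCarrier L k V d n = k - bbscCarrier L k V d (n + 1) := by
    intro n
    rw [bbscCarrier_succ, bbscPass_of_middle (hm n)]
    ring
  have hl := fun n => abs_sub_le_of_middle (c := bbscCarrier L k U c n)
    (u := U (Fin.ofNat N n)) hk (by rw [← hV]; exact hm n)
  simp only [← bbscCarrier_succ] at hl
  have hs : ∀ n, |bbscCarrier L k U c (n + 1) - bbscCarrier L k V d n| =
      |bbscCarrier L k U c (n + 1) - (k - bbscCarrier L k V d (n + 1))| := fun n => by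
    rw [← hD n]
  simp only [hs] at hl
  have key := eq_of_antitone_of_periodic (N := N)
    (a := fun n => -|bbscCarrier L k U c n - (k - bbscCarrier L k V d n)|)
    (fun n => neg_le_neg (hl n).1)
    (fun n => by simp only [hp.periodic n, hd.periodic n])
  simp only [neg_inj] at key
  refine (hl n).2 ((key (n + 1)).trans (key n).symm) fun h => hne ?_
  have := key n
  rw [h, sub_self, abs_zero, bbscCarrier_zero, bbscCarrier_zero] at this
  exact sub_eq_zero.1 (abs_eq_zero.1 this.symm)

/-- A small carrier which is unique on a state is unique on the next state. -/
theorem unique_carrier_of_step {e : ℤ} (hk : k < L) (hp : IsPeriodicCarrier L k U c)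
    (hu : ∀ a b, IsPeriodicCarrier L k U a → IsPeriodicCarrier L k U b → a = b)
    (hV : ∀ n, V (Fin.ofNat N n) = bbscBox L k (U (Fin.ofNat N n)) (bbscCarrier L k U c n))
    (hd : IsPeriodicCarrier L k V d) (he : IsPeriodicCarrier L k V e) : d = e := by
  by_contra hne
  have hmd := carrier_middle_of_ne hk hd he hne
  have hme := carrier_middle_of_ne hk he hd (Ne.symm hne)
  -- As `d ≠ e`, the content `c` differs from at least one of `k - d` and `k - e`, which puts `c` in
  -- the middle regime throughout.
  have hmc : ∀ n, k ≤ U (Fin.ofNat N n) + bbscCarrier L k U c n ∧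
      U (Fin.ofNat N n) + bbscCarrier L k U c n ≤ L := by
    by_cases h : c = k - d
    · exact prev_carrier_middle hk hp hV he hme (by omega)
    · exact prev_carrier_middle hk hp hV hd hmd h
  -- In the middle regime `v = u + 2 * c - k`, so a carrier on `V` lifts to `U` by adding `2 * c -
  -- k`: the sum of box and carrier is unchanged. Two carriers on `V` thus give two on `U`.
  have hlift : ∀ x, IsPeriodicCarrier L k V x →
      (∀ n, k ≤ V (Fin.ofNat N n) + bbscCarrier L k V x n ∧
        V (Fin.ofNat N n) + bbscCarrier L k V x n ≤ L) →
      IsPeriodicCarrier L k U (x + 2 * c - k) := by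
    intro x hx hm
    have key : ∀ n, bbscCarrier L k U (x + 2 * c - k) n =
        bbscCarrier L k V x n + 2 * bbscCarrier L k U c n - k := by
      intro n
      induction n with
      | zero => rfl
      | succ n ih =>
        have h₁ := hm n
        rw [hV, bbscBox_of_middle (hmc n)] at h₁
        rw [bbscCarrier_succ, ih, bbscPass_of_middle (by omega), bbscCarrier_succ,
          bbscPass_of_middle (hm n), bbscCarrier_succ, bbscPass_of_middle (hmc n)]
        ring
    rw [IsPeriodicCarrier, key, show bbscCarrier L k V x N = x from hx,
      show bbscCarrier L k U c N = c from hp]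
  have := hu _ _ (hlift d hd hmd) (hlift e he hme)
  omega

theorem EvolvesPeriodically.step (hE : EvolvesPeriodically L k U) (hk : k < L)
    (hc : 0 ≤ c ∧ c ≤ k) (hp : IsPeriodicCarrier L k U c)
    (hV : ∀ n, V (Fin.ofNat N n) = bbscBox L k (U (Fin.ofNat N n)) (bbscCarrier L k U c n))
    (hVa : IsAdmissible L V) : EvolvesPeriodically L k V := by
  obtain ⟨d, -, -, hd⟩ := hVa.exists_carrier (hc.1.trans hc.2)
  refine ⟨_, ⟨d, hd, fun _ => rfl⟩, ?_⟩
  rintro W ⟨e, he, hW⟩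
  obtain rfl := unique_carrier_of_step hk hp
    (fun a b ha hb => hE.unique_carrier hk.le ha hb) hV hd he
  exact funext hW

end Step

/-! ### Arclines are counted by the balls put into boxes -/

section Arclines

variable {N : ℕ} [NeZero N] {L : ℤ} {l : ℕ} {U : Fin N → ℤ} {c : ℕ}

/-- The number of balls which stay on the carrier when it passes box `n`. -/
def keptCount (L : ℤ) (l : ℕ) (U : Fin N → ℤ) (c n : ℕ) : ℕ :=
  (carrierStack L l U c n).length - (L - U (Fin.ofNat N n)).toNat

/-- The number of balls taken out of box `n`. -/
def takenCount (L : ℤ) (l : ℕ) (U : Fin N → ℤ) (c n : ℕ) : ℕ :=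
  min (U (Fin.ofNat N n)).toNat (l - (carrierStack L l U c n).length)

/-- Reversing puts the bottom of the stack first, so that an index is a height, unchanged by what
happens above it. -/
theorem carrierStack_succ_reverse (n : ℕ) : (carrierStack L l U c (n + 1)).reverse =
    (carrierStack L l U c n).reverse.take (keptCount L l U c n) ++
      (List.range (takenCount L l U c n)).map fun j => some (n, j) := by
  rw [carrierStack, List.reverse_append, List.reverse_drop, takenBalls, List.reverse_reverse]
  rfl

theorem length_carrierStack (hU : ∀ i, 0 ≤ U i ∧ U i ≤ L) (hc : c ≤ l) (n : ℕ) :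
    ((carrierStack L l U c n).length : ℤ) = bbscCarrier L (l : ℤ) U c n := by
  induction n with
  | zero => simp [carrierStack, bbscCarrier]
  | succ n ih =>
    have h₁ := bbscCarrier_mem (l := l) hU (c := c) ⟨by omega, by omega⟩ n
    have h₂ := hU (Fin.ofNat N n)
    rw [bbscCarrier_succ, ← ih, bbscPass, bbscBox_coe, carrierStack, List.length_append,
      takenBalls]
    rw [← ih] at h₁
    simp only [List.length_reverse, List.length_map, List.length_range, List.length_drop]
    omega

theorem length_carrierStack_reverse_take (n : ℕ) :
    ((carrierStack L l U c n).reverse.take (keptCount L l U c n)).length = keptCount L l U c n := by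
  rw [List.length_take, List.length_reverse, keptCount]
  omega

/-- The ball `j` of box `n` keeps its height on the carrier until it is put into a box. -/
theorem getElem?_carrierStack_reverse (k p n j : ℕ) :
    (carrierStack L l U c k).reverse[p]? = some (some (n, j)) ↔
      n < k ∧ j < takenCount L l U c n ∧ p = keptCount L l U c n + j ∧
        ∀ i, n < i → i < k → p < keptCount L l U c i := by
  induction k with
  | zero =>
    rw [carrierStack, List.reverse_replicate, List.getElem?_replicate]
    split_ifs <;> simp
  | succ k ih =>
    rw [carrierStack_succ_reverse]
    rcases lt_or_ge p (keptCount L l U c k) with hp | hp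
    · rw [List.getElem?_append_left (by rwa [length_carrierStack_reverse_take]),
        List.getElem?_take_of_lt hp, ih]
      constructor
      · rintro ⟨h₁, h₂, h₃, h₄⟩
        refine ⟨by omega, h₂, h₃, fun i hi hik => ?_⟩
        rcases Nat.lt_succ_iff_lt_or_eq.1 hik with h | rfl
        · exact h₄ i hi h
        · exact hp
      · rintro ⟨h₁, h₂, h₃, h₄⟩
        refine ⟨?_, h₂, h₃, fun i hi hik => h₄ i hi (by omega)⟩
        rcases Nat.lt_succ_iff_lt_or_eq.1 h₁ with h | rfl
        · exact h
        · omega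
    · rw [List.getElem?_append_right (by rwa [length_carrierStack_reverse_take]),
        length_carrierStack_reverse_take, List.getElem?_map, Option.map_eq_some_iff]
      constructor
      · rintro ⟨a, ha, h⟩
        rw [List.getElem?_eq_some_iff] at ha
        obtain ⟨ha, rfl⟩ := ha
        simp only [List.length_range, List.getElem_range, Option.some.injEq, Prod.mk.injEq]
          at ha h
        obtain ⟨rfl, rfl⟩ := h
        exact ⟨by omega, ha, by omega, fun i hi hik => by omega⟩
      · rintro ⟨h₁, h₂, h₃, h₄⟩
        obtain rfl : n = k := by
          by_contra hne
          have := h₄ k (by omega) (by omega)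
          omega
        refine ⟨j, ?_, rfl⟩
        rw [List.getElem?_range (by omega)]
        congr 1
        omega

/-- Turns the position `s` counted from the top into the height `p` counted from the bottom. -/
theorem mem_arclines_iff (n j k s : ℕ) : ((n, j), (k, s)) ∈ arclines L l U c ↔
    n < N ∧ s < (L - U (Fin.ofNat N k)).toNat ∧ ∃ p, p + s + 1 = (carrierStack L l U c k).length ∧
      (carrierStack L l U c k).reverse[p]? = some (some (n, j)) := by
  simp only [arclines, Set.mem_ofPred_eq, putBalls]
  refine and_congr_right fun _ => ?_
  rcases lt_or_ge s (L - U (Fin.ofNat N k)).toNat with hs | hs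
  · rw [List.getElem?_take_of_lt hs]
    constructor
    · intro h
      obtain ⟨hlt, -⟩ := List.getElem?_eq_some_iff.1 h
      refine ⟨hs, (carrierStack L l U c k).length - 1 - s, by omega, ?_⟩
      rw [List.getElem?_reverse (by omega), ← h]
      congr 1
      omega
    · rintro ⟨-, p, hp, h⟩
      rw [List.getElem?_reverse (by omega)] at h
      rw [← h]
      congr 1
      omega
  · rw [List.getElem?_take, if_neg (by omega)]
    simp only [reduceCtorEq, false_iff]
    omega

/-- A ball at height `p` is put at the first later box where the kept part of the stack has at most
`p` balls, hence only once. -/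
theorem arclines_injOn : Set.InjOn Prod.fst (arclines L l U c) := by
  rintro ⟨⟨n, j⟩, k, s⟩ h ⟨⟨n', j'⟩, k', s'⟩ h' heq
  obtain ⟨rfl, rfl⟩ := Prod.mk.inj heq
  rw [mem_arclines_iff] at h h'
  obtain ⟨-, hs, p, hp, hk⟩ := h
  obtain ⟨-, hs', p', hp', hk'⟩ := h'
  obtain ⟨h₁, -, h₂, h₃⟩ := (getElem?_carrierStack_reverse ..).1 hk
  obtain ⟨h₁', -, h₂', h₃'⟩ := (getElem?_carrierStack_reverse ..).1 hk'
  have h₄ : keptCount L l U c k ≤ p := by rw [keptCount]; omega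
  have h₄' : keptCount L l U c k' ≤ p' := by rw [keptCount]; omega
  have hkk : k = k' := by
    rcases lt_trichotomy k k' with h | h | h
    · have := h₃' k h₁ h; omega
    · exact h
    · have := h₃ k' h₁' h; omega
  subst hkk
  have : s = s' := by omega
  rw [this]

theorem arclines_image_fst (hper : ∀ n, keptCount L l U c (n + N) = keptCount L l U c n) :
    Prod.fst '' arclines L l U c =
      ((Finset.range N).sigma fun n => Finset.range (takenCount L l U c n)).map
        (Equiv.sigmaEquivProd ℕ ℕ).toEmbedding := by
  classical
  ext ⟨n, j⟩
  simp only [Set.mem_image, Prod.exists, Finset.coe_map, Finset.mem_coe, Finset.mem_sigma,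
    Finset.mem_range, Sigma.exists, Equiv.coe_toEmbedding, Equiv.sigmaEquivProd_apply,
    Prod.mk.injEq]
  constructor
  · rintro ⟨n', j', k, s, h, rfl, rfl⟩
    obtain ⟨hn, -, p, -, hp⟩ := (mem_arclines_iff ..).1 h
    exact ⟨n', j', ⟨hn, ((getElem?_carrierStack_reverse ..).1 hp).2.1⟩, rfl, rfl⟩
  · rintro ⟨n', j', ⟨hn, hj⟩, rfl, rfl⟩
    -- A ball lands after one period at the latest: the kept part has then returned to its size at
    -- box `n'`, which is at most the height of the ball.
    have hex : ∃ k, n' < k ∧ keptCount L l U c k ≤ keptCount L l U c n' + j' :=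
      ⟨n' + N, by have := NeZero.pos N; omega, by rw [hper]; omega⟩
    obtain ⟨h₁, h₂⟩ := Nat.find_spec hex
    set k := Nat.find hex with hk
    have hp : (carrierStack L l U c k).reverse[keptCount L l U c n' + j']? =
        some (some (n', j')) := by
      refine (getElem?_carrierStack_reverse ..).2 ⟨h₁, hj, rfl, fun i hi hik => ?_⟩
      by_contra hcon
      exact Nat.find_min hex hik ⟨hi, not_lt.1 hcon⟩
    obtain ⟨hlt, -⟩ := List.getElem?_eq_some_iff.1 hp
    rw [List.length_reverse] at hlt
    have hkept : keptCount L l U c k =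
      (carrierStack L l U c k).length - (L - U (Fin.ofNat N k)).toNat := rfl
    refine ⟨n', j', k, (carrierStack L l U c k).length - 1 - (keptCount L l U c n' + j'),
      (mem_arclines_iff ..).2 ⟨hn, by omega, _, by omega, hp⟩, rfl, rfl⟩

/-- The number of arclines is the number of balls put into the boxes in one period. -/
theorem arclines_finite_ncard (hU : ∀ i, 0 ≤ U i ∧ U i ≤ L) (hc : c ≤ l)
    (hp : IsPeriodicCarrier L (l : ℤ) U c) :
    (arclines L l U c).Finite ∧ ((arclines L l U c).ncard : ℤ) =
      ∑ n ∈ Finset.range N, min (bbscCarrier L (l : ℤ) U c n) (L - U (Fin.ofNat N n)) := by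
  have hlen := length_carrierStack hU hc
  have hper : ∀ n, keptCount L l U c (n + N) = keptCount L l U c n := by
    intro n
    have : (carrierStack L l U c (n + N)).length = (carrierStack L l U c n).length := by
      have h := hp.periodic n
      rw [← hlen, ← hlen] at h
      exact_mod_cast h
    rw [keptCount, keptCount, this, Fin.ofNat_add_period]
  have himage := arclines_image_fst hper
  have hfin : (arclines L l U c).Finite :=
    Set.Finite.of_finite_image (himage ▸ Finset.finite_toSet _) arclines_injOn
  refine ⟨hfin, ?_⟩
  rw [← arclines_injOn.ncard_image, himage, Set.ncard_coe_finset, Finset.card_map,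
    Finset.card_sigma, Nat.cast_sum, ← sub_eq_zero, ← Finset.sum_sub_distrib]
  -- The arclines were counted by their starting points, as balls taken. Taken minus put is the gain
  -- of the carrier, which sums to zero over a period.
  calc _ = ∑ n ∈ Finset.range N,
        (bbscCarrier L (l : ℤ) U c (n + 1) - bbscCarrier L (l : ℤ) U c n) := by
        refine Finset.sum_congr rfl fun n _ => ?_
        have h₁ := bbscCarrier_mem (l := l) hU (c := c) ⟨by omega, by omega⟩ n
        have h₂ := hU (Fin.ofNat N n)
        rw [bbscCarrier_succ, bbscPass, bbscBox_coe, Finset.card_range, takenCount]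
        rw [← hlen] at h₁ ⊢
        omega
    _ = 0 := by
      rw [Finset.sum_range_sub, show bbscCarrier L (l : ℤ) U c N = c from hp, bbscCarrier_zero,
        sub_self]

theorem isArclineNumber_iff (hU : ∀ i, 0 ≤ U i ∧ U i ≤ L) (k : ℕ) : IsArclineNumber L l U k ↔
    ∃ c : ℤ, (0 ≤ c ∧ c ≤ l) ∧ IsPeriodicCarrier L (l : ℤ) U c ∧
      (k : ℤ) = ∑ n ∈ Finset.range N,
        min (bbscCarrier L (l : ℤ) U c n) (L - U (Fin.ofNat N n)) := by
  constructor
  · rintro ⟨c, hc, hp, -, rfl⟩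
    exact ⟨c, ⟨by omega, by omega⟩, hp, (arclines_finite_ncard hU hc hp).2⟩
  · rintro ⟨c, ⟨h₀, hc⟩, hp, hk⟩
    obtain ⟨c, rfl⟩ := Int.eq_ofNat_of_zero_le h₀
    have h := arclines_finite_ncard hU (by omega) hp
    exact ⟨c, by omega, hp, h.1, by exact_mod_cast h.2.trans hk.symm⟩

theorem IsAdmissible.existsUnique_isArclineNumber (hU : IsAdmissible L U) (l : ℕ) :
    ∃! k : ℕ, IsArclineNumber L l U k := by
  obtain ⟨c, h₀, h₁, hc⟩ := hU.exists_carrier (Int.natCast_nonneg l)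
  have hput : 0 ≤ ∑ n ∈ Finset.range N,
      min (bbscCarrier L (l : ℤ) U c n) (L - U (Fin.ofNat N n)) :=
    Finset.sum_nonneg fun n _ =>
      le_min (bbscCarrier_mem hU.mem ⟨h₀, h₁⟩ n).1 (sub_nonneg.2 (hU.mem _).2)
  obtain ⟨k, hk⟩ := Int.eq_ofNat_of_zero_le hput
  refine ⟨k, (isArclineNumber_iff hU.mem k).2 ⟨c, ⟨h₀, h₁⟩, hc, hk.symm⟩, fun k' hk' => ?_⟩
  obtain ⟨d, -, hd, h⟩ := (isArclineNumber_iff hU.mem k').1 hk'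
  rw [sum_put_eq hc hd, hk] at h
  exact_mod_cast h

theorem arclineNumber_spec (h : ∃ k, IsArclineNumber L l U k) :
    IsArclineNumber L l U (arclineNumber L l U) := by
  rw [arclineNumber, dif_pos h]
  exact h.choose_spec

end Arclines

/-! ### Conservation in time and reduction to the shifted system -/

section Conservation

variable {N : ℕ} [NeZero N] {L : ℤ} {U V : Fin N → ℤ} {κ : WithTop ℤ}

/-- Time evolution preserves admissibility, the existence of the evolution and all numbers of
arclines. -/
theorem IsPeriodicStep.conserved (hκ : 0 ≤ κ) (hU : IsAdmissible L U)
    (hE : EvolvesPeriodically L κ U) (hV : IsPeriodicStep L κ U V) :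
    IsAdmissible L V ∧ EvolvesPeriodically L κ V ∧
      ∀ l, arclineNumber L l V = arclineNumber L l U := by
  obtain ⟨k, c, hc, hp, hVc, hk⟩ := hV.exists_finite hκ hU hE
  have hVa := hU.step hc hp hVc
  refine ⟨hVa, ?_, fun l => ?_⟩
  · rcases le_or_gt (L : WithTop ℤ) κ with h | h
    · exact hVa.evolves_of_le h
    · obtain rfl := hk.resolve_left (not_le.2 h)
      exact hE.step (WithTop.coe_lt_coe.1 h) hc hp hVc hVa
  · have hn := arclineNumber_spec (hVa.existsUnique_isArclineNumber l).exists
    obtain ⟨d, hd, hq, hsum⟩ := (isArclineNumber_iff hVa.mem _).1 hn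
    obtain ⟨e, he, hr, hsum'⟩ := exists_carrier_of_step hU.mem hc hp hVc hVa.mem hd hq
    exact (hU.existsUnique_isArclineNumber l).unique
      ((isArclineNumber_iff hU.mem _).2 ⟨e, he, hr, hsum.trans hsum'⟩)
      (arclineNumber_spec (hU.existsUnique_isArclineNumber l).exists)

theorem existsUnique_evolution {S : Type*} {R : S → S → Prop} {P : S → Prop}
    (hex : ∀ s, P s → ∃! s', R s s') (hP : ∀ s s', P s → R s s' → P s') {s₀ : S} (h₀ : P s₀) :
    ∃! u : ℕ → S, u 0 = s₀ ∧ ∀ t, R (u t) (u (t + 1)) := by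
  choose f hf using fun s : {s // P s} => (hex s s.2).exists
  let w : ℕ → {s // P s} := fun t =>
    t.rec ⟨s₀, h₀⟩ fun _ s => ⟨f s, hP s (f s) s.2 (hf s)⟩
  refine ⟨fun t => (w t).1, ⟨rfl, fun t => hf (w t)⟩, ?_⟩
  rintro u ⟨hu₀, hu⟩
  funext t
  induction t with
  | zero => exact hu₀
  | succ t ih =>
    refine (hex _ (w t).2).unique ?_ (hf (w t))
    have := hu t
    rwa [ih] at this

/-- Both arguments of the minimum grow by `m`, while the overflow is unchanged because `u + c` and
the carrier capacity both grow by `2 * m`. -/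
theorem bbscBox_shift (m : ℕ) (L u c : ℤ) (κ : WithTop ℤ) :
    bbscBox (L + 2 * m) (κ + (2 * m : ℤ)) (u + m) (c + m) = bbscBox L κ u c + m := by
  cases κ with
  | top => rw [WithTop.top_add, bbscBox_top, bbscBox_top]; omega
  | coe k => rw [← WithTop.coe_add, bbscBox_coe, bbscBox_coe]; omega

theorem bbscCarrier_shift (m : ℕ) (c : ℤ) (n : ℕ) :
    bbscCarrier (L + 2 * m) (κ + (2 * m : ℤ)) (upShift m U) (c + m) n =
      bbscCarrier L κ U c n + m := by
  induction n with
  | zero => rfl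
  | succ n ih =>
    rw [bbscCarrier_succ, ih, bbscCarrier_succ, bbscPass, bbscPass, upShift, bbscBox_shift]
    ring

theorem isPeriodicStep_shift (m : ℕ) :
    IsPeriodicStep (L + 2 * m) (κ + (2 * m : ℤ)) (upShift m U) (upShift m V) ↔
      IsPeriodicStep L κ U V := by
  have hshift : ∀ c, (IsPeriodicCarrier (L + 2 * m) (κ + (2 * m : ℤ)) (upShift m U) (c + m) ∧
      ∀ i : Fin N, upShift m V i = bbscBox (L + 2 * m) (κ + (2 * m : ℤ)) (upShift m U i)
        (bbscCarrier (L + 2 * m) (κ + (2 * m : ℤ)) (upShift m U) (c + m) i)) ↔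
      (IsPeriodicCarrier L κ U c ∧ ∀ i : Fin N, V i = bbscBox L κ (U i) (bbscCarrier L κ U c i)) := by
    intro c
    simp only [IsPeriodicCarrier, bbscCarrier_shift, upShift, bbscBox_shift, add_left_inj]
  constructor
  · rintro ⟨c, h⟩
    exact ⟨c - m, (hshift (c - m)).1 (by rwa [sub_add_cancel])⟩
  · rintro ⟨c, h⟩
    exact ⟨c + m, (hshift c).2 h⟩

theorem evolvesPeriodically_shift (m : ℕ) :
    EvolvesPeriodically (L + 2 * m) (κ + (2 * m : ℤ)) (upShift m U) ↔
      EvolvesPeriodically L κ U := by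
  have hbij : Function.Bijective (upShift m : (Fin N → ℤ) → Fin N → ℤ) :=
    ⟨fun V W h => funext fun i => add_right_cancel (congrFun h i),
      fun V => ⟨fun i => V i - m, funext fun i => sub_add_cancel _ _⟩⟩
  rw [EvolvesPeriodically, EvolvesPeriodically, hbij.existsUnique_iff]
  simp only [isPeriodicStep_shift]

end Conservation

theorem mainTheorem5 (N : ℕ) [NeZero N] (L : ℤ) (m : ℕ) (U₀ : Fin N → ℤ)
    (hphys : ∀ i, 0 ≤ upShift m U₀ i ∧ upShift m U₀ i ≤ L + 2 * m)
    (hinit : HasPeriodicSystems (L + 2 * m) (upShift m U₀))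
    (hvac : HasPeriodicSystems (L + 2 * m) (vacuum N m))
    (κ : WithTop ℤ) (hκ : 0 ≤ κ + (2 * m : ℤ))
    (hevol : (L : WithTop ℤ) ≤ κ ∨ EvolvesPeriodically L κ U₀) :
    (∃! U : ℕ → Fin N → ℤ, U 0 = U₀ ∧ ∀ t, IsPeriodicStep L κ (U t) (U (t + 1))) ∧
    (∀ l : ℕ, ∃! k : ℕ, IsArclineNumber (L + 2 * m) l (vacuum N m) k) ∧
    ∀ U : ℕ → Fin N → ℤ, U 0 = U₀ → (∀ t, IsPeriodicStep L κ (U t) (U (t + 1))) →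
      ∀ t : ℕ,
        EvolvesPeriodically L κ (U t) ∧
        (∀ i, 0 ≤ upShift m (U t) i ∧ upShift m (U t) i ≤ L + 2 * m) ∧
        (∀ l : ℕ, ∃! k : ℕ, IsArclineNumber (L + 2 * m) l (upShift m (U t)) k) ∧
        ∀ l : ℕ, 1 ≤ l →
          arclineDiff (L + 2 * m) l (upShift m (U t)) =
            arclineDiff (L + 2 * m) l (upShift m U₀) ∧
          conservedQuantity L m l (U t) = conservedQuantity L m l U₀ := by
  have hadm := hinit.isAdmissible hphys
  have hevol₀ : EvolvesPeriodically L κ U₀ := by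
    refine hevol.elim (fun h => (evolvesPeriodically_shift m).1 (hadm.evolves_of_le ?_)) id
    exact_mod_cast add_le_add_left h ((2 * m : ℤ) : WithTop ℤ)
  let P : (Fin N → ℤ) → Prop := fun W => IsAdmissible (L + 2 * m) (upShift m W) ∧
    EvolvesPeriodically L κ W ∧
    ∀ l, arclineNumber (L + 2 * m) l (upShift m W) = arclineNumber (L + 2 * m) l (upShift m U₀)
  have hP₀ : P U₀ := ⟨hadm, hevol₀, fun _ => rfl⟩
  have hP : ∀ W W', P W → IsPeriodicStep L κ W W' → P W' := by
    rintro W W' ⟨h₁, h₂, h₃⟩ h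
    obtain ⟨h₄, h₅, h₆⟩ := ((isPeriodicStep_shift m).2 h).conserved hκ h₁
      ((evolvesPeriodically_shift m).2 h₂)
    exact ⟨h₄, (evolvesPeriodically_shift m).1 h₅, fun l => (h₆ l).trans (h₃ l)⟩
  refine ⟨existsUnique_evolution (fun W hW => hW.2.1) hP hP₀, fun l => ?_, fun U hU₀ hU t => ?_⟩
  · refine (hvac.isAdmissible fun i => ?_).existsUnique_isArclineNumber l
    -- The bound `m ≤ L + 2 * m` is not assumed for the vacuum. It follows from half filling, which
    -- gives `2 * m ≤ L + 2 * m`.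
    obtain ⟨V, ⟨c, hc, -⟩, -⟩ := hvac.1 ⊤ le_top
    have h := hc.sum_le
    simp only [vacuum, Finset.sum_const, Finset.card_univ, Fintype.card_fin, nsmul_eq_mul] at h ⊢
    have hN : (0 : ℤ) < N := by exact_mod_cast NeZero.pos N
    have : (2 * m : ℤ) ≤ L + 2 * m := le_of_mul_le_mul_left (by linarith) hN
    omega
  · have hPt : P (U t) := by
      induction t with
      | zero => rwa [hU₀]
      | succ t ih => exact hP _ _ ih (hU t)
    obtain ⟨h₁, h₂, h₃⟩ := hPt
    have hdiff : ∀ l, arclineDiff (L + 2 * m) l (upShift m (U t)) =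
        arclineDiff (L + 2 * m) l (upShift m U₀) := fun l => by
      rw [arclineDiff, arclineDiff, h₃, h₃]
    exact ⟨h₂, h₁.mem, h₁.existsUnique_isArclineNumber,
      fun l _ => ⟨hdiff l, by rw [conservedQuantity, conservedQuantity, hdiff]⟩⟩
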